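/- Let $\mathcal A$ be a (complex, not necessarily unital) C*-algebra, let $\mathcal B$ be a C*-subalgebra of $\mathcal A$ (that is, a norm-closed $*$-subalgebra), and let $L$ be the pull-back to $\mathcal A$ of the quotient norm on $\mathcal A/\mathcal B$, that is, the seminorm $$L(A) = \inf\{\|A-B\| : B \in \mathcal B\}, \qquad A \in \mathcal A .$$ Assume that $\mathcal B$ contains a bounded approximate identity for $\mathcal A$, that is, there is a norm-bounded net $(E_\lambda)$ in $\mathcal B$ such that $\|E_\lambda A - A\| \to 0$ and $\|A E_\lambda - A\| \to 0$ for every $A \in \mathcal A$. Then $L$ is Leibniz, that is, $$L(AC) \le L(A)\|C\| + \|A\|L(C) \quad\text{for all } A, C \in \mathcal A .$$ If $\mathcal A$ is unital and $1_{\mathcal A} \in \mathcal B$, then $L$ is strongly Leibniz, that is, $L$ is Leibniz, $L(1_{\mathcal A}) = 0$, and for every $A$ that is invertible in $\mathcal A$, $$L(A^{-1}) \le \|A^{-1}\|^2 L(A) .$$ -/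

import Mathlib

/-- `B` contains a bounded approximate identity for `A`. The net is encoded by a (nontrivial)
filter on `A` along which `a * e → a` and `e * a → a` for every `a : A`, and which is supported
on a norm-bounded set of elements of `B`. -/
def ContainsBoundedApproxIdentity {A : Type*} [NonUnitalCStarAlgebra A]
    (B : NonUnitalStarSubalgebra ℂ A) : Prop :=
  ∃ l : Filter A, l.IsApproximateUnit ∧ ∃ M : ℝ, ∀ᶠ e in l, e ∈ B ∧ ‖e‖ ≤ M

/-- The quotient seminorm of `A / B` pulled back to `A`: `L a = inf {‖a - b‖ : b ∈ B}`. -/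
noncomputable def quotientSeminorm {A : Type*} [NonUnitalCStarAlgebra A]
    (B : NonUnitalStarSubalgebra ℂ A) : Seminorm ℂ A :=
  Seminorm.ofSMulLE (fun a : A => ⨅ b : B, ‖a - (b : A)‖)
    (le_antisymm
      (ciInf_le_of_le ⟨0, Set.forall_mem_range.2 fun _ => norm_nonneg _⟩ (0 : B) (by simp))
      (le_ciInf fun _ => norm_nonneg _))
    (fun x y => le_ciInf_add_ciInf fun b c =>
      ciInf_le_of_le ⟨0, Set.forall_mem_range.2 fun _ => norm_nonneg _⟩ (b + c) (by
        have h : x + y - ((b + c : B) : A) = (x - b) + (y - c) := by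
          push_cast
          abel
        rw [h]
        exact norm_add_le _ _))
    (fun r x => by
      rw [Real.mul_iInf_of_nonneg (norm_nonneg r)]
      exact le_ciInf fun b =>
        ciInf_le_of_le ⟨0, Set.forall_mem_range.2 fun _ => norm_nonneg _⟩ (r • b) (by
          rw [← norm_smul, smul_sub]
          exact le_rfl))

theorem quotientSeminorm_apply {A : Type*} [NonUnitalCStarAlgebra A]
    (B : NonUnitalStarSubalgebra ℂ A) (a : A) :
    quotientSeminorm B a = ⨅ b : B, ‖a - (b : A)‖ := rfl

/-- A seminorm on a C⋆-algebra is Leibniz. -/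
def IsLeibniz {A : Type*} [NonUnitalCStarAlgebra A] (L : Seminorm ℂ A) : Prop :=
  ∀ a c : A, L (a * c) ≤ L a * ‖c‖ + ‖a‖ * L c

/-- A seminorm on a unital C⋆-algebra is strongly Leibniz. -/
structure IsStronglyLeibniz {A : Type*} [CStarAlgebra A] (L : Seminorm ℂ A) : Prop where
  isLeibniz : IsLeibniz L
  map_one : L 1 = 0
  map_inv_le : ∀ u : Aˣ, L (↑u⁻¹ : A) ≤ ‖(↑u⁻¹ : A)‖ ^ 2 * L (u : A)

/-!
By Hahn–Banach there is a functional `ψ` with `|ψ| ≤ L` and `ψ a = L a`; in particular `|ψ| ≤ ‖·‖`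
and `ψ` vanishes on `B`. Separating the unit ball from the elements that a positive functional
must send above `1`, one finds a contractive positive functional dominating `|ψ|²`, and its GNS
representation `π` yields vectors `ξ`, `η` in the unit ball with `ψ = ⟪η, π(·) ξ⟫`. Let `p` be the
projection onto the closure of `π(B) ξ`. It commutes with `π(B)`, and `‖[p, x]‖ ≤ ‖x‖` for every
`x`, so `‖[p, π(·)]‖ ≤ L`. At `a` there is equality: `p η = 0`, while `π(a) p ξ = π(a) ξ` because
`a` is a limit of products `a b` with `b ∈ B`, whence `⟪η, [p, π(a)] p ξ⟫ = -ψ a = -L a`. The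
(strong) Leibniz inequalities for the derivation `[p, π(·)]` therefore pass to `L`.
-/

open scoped ComplexOrder InnerProductSpace

universe u

section HahnBanach

variable {𝕜 E F H : Type*} [RCLike 𝕜] [AddCommGroup E] [Module 𝕜 E] [AddCommGroup F] [Module 𝕜 F]
  [NormedAddCommGroup H] [InnerProductSpace 𝕜 H]

theorem exists_dual_comp_eq_of_norm_le_seminorm (T : E →ₗ[𝕜] F) (ψ : Module.Dual 𝕜 E)
    (p : Seminorm 𝕜 F) (h : ∀ x, ‖ψ x‖ ≤ p (T x)) :
    ∃ g : Module.Dual 𝕜 F, (∀ x, g (T x) = ψ x) ∧ ∀ y, ‖g y‖ ≤ p y := by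
  have hker : ψ ∈ (LinearMap.ker T).dualAnnihilator := by
    rw [Submodule.mem_dualAnnihilator]
    intro x hx
    simpa [LinearMap.mem_ker.1 hx] using h x
  rw [← LinearMap.range_dualMap_eq_dualAnnihilator_ker] at hker
  obtain ⟨f, rfl⟩ := hker
  obtain ⟨g, hgf, hg⟩ := Module.Dual.exists_extension_of_le_seminorm (LinearMap.range T)
    (f.domRestrict (LinearMap.range T)) (p := p) (by rintro ⟨_, x, rfl⟩; exact h x)
  exact ⟨g, fun x => hgf ⟨T x, x, rfl⟩, hg⟩

theorem exists_dual_eq_seminorm (p : Seminorm 𝕜 E) (a : E) :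
    ∃ ψ : Module.Dual 𝕜 E, (∀ x, ‖ψ x‖ ≤ p x) ∧ ψ a = p a := by
  obtain ⟨ψ, hψa, hψ⟩ := exists_dual_comp_eq_of_norm_le_seminorm
    (LinearMap.toSpanSingleton 𝕜 E a) (LinearMap.toSpanSingleton 𝕜 𝕜 (p a : 𝕜)) p fun z => by
      simp [map_smul_eq_mul, abs_of_nonneg (apply_nonneg p a)]
  exact ⟨ψ, hψ, by simpa using hψa 1⟩

theorem exists_inner_eq_of_norm_le [CompleteSpace H] (T : E →ₗ[𝕜] H) (ψ : Module.Dual 𝕜 E)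
    (h : ∀ x, ‖ψ x‖ ≤ ‖T x‖) : ∃ η : H, ‖η‖ ≤ 1 ∧ ∀ x, ψ x = ⟪η, T x⟫_𝕜 := by
  obtain ⟨g, hgT, hg⟩ := exists_dual_comp_eq_of_norm_le_seminorm T ψ (normSeminorm 𝕜 H) h
  let G : StrongDual 𝕜 H := g.mkContinuous 1 fun y => by simpa using hg y
  refine ⟨(InnerProductSpace.toDual 𝕜 H).symm G, ?_, fun x => ?_⟩
  · simpa using g.mkContinuous_norm_le zero_le_one _
  · simp [G, hgT]

theorem exists_le_norm_and_one_le_of_convex {V : Type*} [SeminormedAddCommGroup V]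
    [NormedSpace ℝ V] {S : Set V} (hS : Convex ℝ S) (h1 : ∀ x ∈ S, 1 ≤ ‖x‖) :
    ∃ f : V →ₗ[ℝ] ℝ, (∀ x, f x ≤ ‖x‖) ∧ ∀ x ∈ S, 1 ≤ f x := by
  have hdisj : Disjoint (Metric.ball 0 1) S :=
    Set.disjoint_left.2 fun x hball hx => (mem_ball_zero_iff.1 hball).not_ge (h1 x hx)
  obtain ⟨f, u, hfball, hfS⟩ :=
    geometric_hahn_banach_open (convex_ball 0 1) Metric.isOpen_ball hS hdisj
  have hu : 0 < u := by simpa using hfball 0 (Metric.mem_ball_self one_pos)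
  refine ⟨u⁻¹ • f.toLinearMap, fun x => (inv_mul_le_iff₀ hu).2 ?_,
    fun x hx => (le_inv_mul_iff₀ hu).2 (by simpa using hfS x hx)⟩
  by_contra! hlt
  have hfx : 0 < f x := (by positivity : 0 ≤ u * ‖x‖).trans_lt hlt
  have hmem : (u / f x) • x ∈ Metric.ball 0 1 := by
    rw [mem_ball_zero_iff, norm_smul, Real.norm_of_nonneg (by positivity), div_mul_eq_mul_div]
    exact (div_lt_one hfx).2 hlt
  have hlt_self := hfball _ hmem
  rw [map_smul, smul_eq_mul, div_mul_cancel₀ u hfx.ne'] at hlt_self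
  exact hlt_self.false

end HahnBanach

section Domination

theorem star_convexCombo_mul_le {A : Type*} [NonUnitalRing A] [StarRing A] [Module ℝ A]
    [IsScalarTower ℝ A A] [SMulCommClass ℝ A A] [StarModule ℝ A] [PartialOrder A]
    [StarOrderedRing A] [PosSMulMono ℝ A] (x y : A) {s t : ℝ} (hs : 0 ≤ s) (ht : 0 ≤ t)
    (hst : s + t = 1) :
    star (s • x + t • y) * (s • x + t • y) ≤ s • (star x * x) + t • (star y * y) := by
  have hdefect : s • (star x * x) + t • (star y * y) - star (s • x + t • y) * (s • x + t • y)
      = (s * t) • (star (x - y) * (x - y)) := by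
    obtain rfl : t = 1 - s := by linarith
    simp only [star_add, star_sub, star_smul, star_trivial, add_mul, mul_add, sub_mul, mul_sub,
      smul_mul_assoc, mul_smul_comm]
    module
  rw [← sub_nonneg, hdefect]
  exact smul_nonneg (mul_nonneg hs ht) (star_mul_self_nonneg _)

variable {A E : Type*} [NonUnitalCStarAlgebra A] [PartialOrder A] [AddCommGroup E] [Module ℂ E]

/-- The self-adjoint elements lying above `star (j x) * j x` for some `x` with `ψ x = 1`. A positive
functional `φ` satisfies `‖ψ x‖ ^ 2 ≤ φ (star (j x) * j x)` for all `x` exactly when it is at least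
`1` on this set. -/
def dominatingSet (j : E →ₗ[ℂ] A) (ψ : Module.Dual ℂ E) : Set (selfAdjoint A) :=
  {h | ∃ x, ψ x = 1 ∧ star (j x) * j x ≤ h}

theorem norm_sq_le_of_one_le_on_dominatingSet {j : E →ₗ[ℂ] A} {ψ : Module.Dual ℂ E}
    {f : selfAdjoint A →ₗ[ℝ] ℝ} (hf : ∀ k ∈ dominatingSet j ψ, 1 ≤ f k) {x : E} (hx : ψ x ≠ 0) :
    ‖ψ x‖ ^ 2 ≤ f ⟨star (j x) * j x, .star_mul_self _⟩ := by
  set k : selfAdjoint A := ⟨star (j x) * j x, .star_mul_self _⟩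
  have hscale : star ((ψ x)⁻¹ • j x) * ((ψ x)⁻¹ • j x) = (‖ψ x‖ ^ 2)⁻¹ • (star (j x) * j x) := by
    rw [star_smul, smul_mul_smul_comm, ← Complex.coe_smul, RCLike.star_def, RCLike.conj_mul]
    simp
  have hmem : (‖ψ x‖ ^ 2)⁻¹ • k ∈ dominatingSet j ψ :=
    ⟨(ψ x)⁻¹ • x, by simp [hx], by rw [map_smul, hscale]; rfl⟩
  have hone : 1 ≤ (‖ψ x‖ ^ 2)⁻¹ * f k := by simpa only [map_smul, smul_eq_mul] using hf _ hmem
  simpa using (le_inv_mul_iff₀ (by positivity)).1 hone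

variable [StarOrderedRing A]

theorem convex_dominatingSet (j : E →ₗ[ℂ] A) (ψ : Module.Dual ℂ E) :
    Convex ℝ (dominatingSet j ψ) := by
  rintro h ⟨x, hx, hxh⟩ k ⟨y, hy, hyk⟩ s t hs ht hst
  refine ⟨(s : ℂ) • x + (t : ℂ) • y, ?_, ?_⟩
  · simp [hx, hy, ← Complex.ofReal_add, hst]
  · rw [map_add, map_smul, map_smul, Complex.coe_smul, Complex.coe_smul]
    exact (star_convexCombo_mul_le (j x) (j y) hs ht hst).trans
      (add_le_add (smul_le_smul_of_nonneg_left hxh hs) (smul_le_smul_of_nonneg_left hyk ht))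

theorem one_le_norm_of_mem_dominatingSet {j : E →ₗ[ℂ] A} {ψ : Module.Dual ℂ E}
    (hψ : ∀ x, ‖ψ x‖ ≤ ‖j x‖) {h : selfAdjoint A} (hh : h ∈ dominatingSet j ψ) : 1 ≤ ‖h‖ := by
  obtain ⟨x, hx, hxh⟩ := hh
  have hjx : 1 ≤ ‖j x‖ := by simpa [hx] using hψ x
  calc 1 ≤ ‖j x‖ * ‖j x‖ := one_le_mul_of_one_le_of_one_le hjx hjx
    _ = ‖star (j x) * j x‖ := CStarRing.norm_star_mul_self.symm
    _ ≤ ‖(h : A)‖ := CStarAlgebra.norm_le_norm_of_nonneg_of_le (star_mul_self_nonneg _) hxh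

theorem nonneg_of_one_le_on_dominatingSet {j : E →ₗ[ℂ] A} {ψ : Module.Dual ℂ E} (hψ : ψ ≠ 0)
    {f : selfAdjoint A →ₗ[ℝ] ℝ} (hf : ∀ k ∈ dominatingSet j ψ, 1 ≤ f k)
    {h : selfAdjoint A} (hh : 0 ≤ (h : A)) : 0 ≤ f h := by
  obtain ⟨x, hx⟩ := LinearMap.surjective hψ 1
  let k : selfAdjoint A := ⟨star (j x) * j x, .star_mul_self _⟩
  have hray (n : ℕ) : 1 ≤ f k + n * f h := by
    have hmem : k + n • h ∈ dominatingSet j ψ :=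
      ⟨x, hx, le_add_of_nonneg_right (by simpa using nsmul_nonneg hh n)⟩
    simpa using hf _ hmem
  by_contra! hneg
  obtain ⟨n, hn⟩ := exists_nat_gt (f k / -f h)
  rw [div_lt_iff₀ (neg_pos.2 hneg)] at hn
  linarith [hray n]

theorem exists_positiveLinearMap_re_eq (f : selfAdjoint A →ₗ[ℝ] ℝ)
    (hf : ∀ h : selfAdjoint A, 0 ≤ (h : A) → 0 ≤ f h) :
    ∃ φ : A →ₚ[ℂ] ℂ, ∀ h : selfAdjoint A, (φ h).re = f h := by
  let g : Module.Dual ℝ A := f ∘ₗ realPart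
  have hre (h : selfAdjoint A) : (g.extendRCLike (h : A) : ℂ).re = f h :=
    (Module.Dual.re_extendRCLike_apply (𝕜 := ℂ) g (h : A)).trans (by simp [g])
  have him (h : selfAdjoint A) : (g.extendRCLike (h : A) : ℂ).im = 0 :=
    (Module.Dual.im_extendRCLike_apply (𝕜 := ℂ) g (h : A)).trans (by simp [g, realPart_I_smul])
  refine ⟨PositiveLinearMap.mk₀ g.extendRCLike fun x hx => ?_, hre⟩
  lift x to selfAdjoint A using IsSelfAdjoint.of_nonneg hx
  rw [Complex.nonneg_iff, hre, him]
  exact ⟨hf x hx, rfl⟩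

theorem exists_positiveLinearMap_norm_sq_le (j : E →ₗ[ℂ] A) (ψ : Module.Dual ℂ E)
    (hψ : ∀ x, ‖ψ x‖ ≤ ‖j x‖) :
    ∃ φ : A →ₚ[ℂ] ℂ, (∀ h : selfAdjoint A, (φ h).re ≤ ‖h‖) ∧
      ∀ x, ‖ψ x‖ ^ 2 ≤ (φ (star (j x) * j x)).re := by
  rcases eq_or_ne ψ 0 with rfl | hψ0
  · exact ⟨0, by simp⟩
  obtain ⟨f, hfnorm, hf⟩ := exists_le_norm_and_one_le_of_convex (convex_dominatingSet j ψ)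
    fun _ => one_le_norm_of_mem_dominatingSet hψ
  obtain ⟨φ, hφ⟩ := exists_positiveLinearMap_re_eq f fun _ =>
    nonneg_of_one_le_on_dominatingSet hψ0 hf
  refine ⟨φ, fun h => (hφ h).trans_le (hfnorm h), fun x => ?_⟩
  rcases eq_or_ne (ψ x) 0 with hx | hx
  · simpa [hx] using (Complex.nonneg_iff.1 (map_nonneg φ (star_mul_self_nonneg (j x)))).1
  · exact (norm_sq_le_of_one_le_on_dominatingSet hf hx).trans_eq (hφ _).symm

end Domination

section Representation

theorem exists_rep_eq_inner {A : Type u} [NonUnitalCStarAlgebra A] (ψ : Module.Dual ℂ A)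
    (hψ : ∀ a, ‖ψ a‖ ≤ ‖a‖) :
    ∃ (H : Type u) (_ : NormedAddCommGroup H) (_ : InnerProductSpace ℂ H) (_ : CompleteSpace H)
      (π : A →⋆ₙₐ[ℂ] (H →L[ℂ] H)) (ξ η : H), ‖ξ‖ ≤ 1 ∧ ‖η‖ ≤ 1 ∧
        ∀ a, ψ a = ⟪η, π a ξ⟫_ℂ := by
  let _ := CStarAlgebra.spectralOrder (Unitization ℂ A)
  let _ := CStarAlgebra.spectralOrderedRing (Unitization ℂ A)
  obtain ⟨φ, hφ1, hφ⟩ := exists_positiveLinearMap_norm_sq_le (Unitization.inrHom ℂ ℂ A) ψ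
    fun a => (hψ a).trans_eq (Unitization.norm_inr ..).symm
  let π := φ.gnsNonUnitalStarAlgHom.comp (Unitization.inrNonUnitalStarAlgHom ℂ A)
  let ξ : φ.GNS := φ.toPreGNS 1
  have hπξ (a : A) : π a ξ = φ.toPreGNS (a : Unitization ℂ A) := by
    simp [π, ξ]
  obtain ⟨η, hη, hψη⟩ := exists_inner_eq_of_norm_le
    ((ContinuousLinearMap.apply ℂ φ.GNS ξ).toLinearMap ∘ₗ (π : A →ₗ[ℂ] φ.GNS →L[ℂ] φ.GNS)) ψ
    fun a => by
      change _ ≤ ‖π a ξ‖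
      rw [hπξ, UniformSpace.Completion.norm_coe, φ.preGNS_norm_def]
      exact Real.le_sqrt_of_sq_le (hφ a)
  refine ⟨φ.GNS, inferInstance, inferInstance, inferInstance, π, ξ, η, ?_, hη, hψη⟩
  rw [UniformSpace.Completion.norm_coe, φ.preGNS_norm_def, Real.sqrt_le_one]
  simpa using hφ1 1

end Representation

section Commutator

theorem norm_lie_le_of_isStarProjection {D : Type*} [CStarAlgebra D] {p : D}
    (hp : IsStarProjection p) (x : D) : ‖⁅p, x⁆‖ ≤ ‖x‖ := by
  have hu := hp.two_mul_sub_one_mem_unitary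
  have hlie : (2 : ℝ) • ⁅p, x⁆ = (2 * p - 1) * x - x * (2 * p - 1) := by
    rw [Ring.lie_def, two_smul]
    noncomm_ring
  have hnorm : 2 * ‖⁅p, x⁆‖ ≤ ‖x‖ + ‖x‖ :=
    calc 2 * ‖⁅p, x⁆‖ = ‖(2 * p - 1) * x - x * (2 * p - 1)‖ := by
          rw [← hlie, norm_smul, Real.norm_two]
      _ ≤ ‖(2 * p - 1) * x‖ + ‖x * (2 * p - 1)‖ := norm_sub_le _ _
      _ = ‖x‖ + ‖x‖ := by
          rw [CStarRing.norm_mem_unitary_mul _ hu, CStarRing.norm_mul_mem_unitary _ hu]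
  linarith

theorem norm_lie_mul_le {R : Type*} [NonUnitalSeminormedRing R] (p x y : R) :
    ‖⁅p, x * y⁆‖ ≤ ‖⁅p, x⁆‖ * ‖y‖ + ‖x‖ * ‖⁅p, y⁆‖ := by
  have hleibniz : ⁅p, x * y⁆ = ⁅p, x⁆ * y + x * ⁅p, y⁆ := by
    simp only [Ring.lie_def]
    noncomm_ring
  rw [hleibniz]
  exact norm_add_le_of_le (norm_mul_le _ _) (norm_mul_le _ _)

theorem lie_map_units_inv {A R F : Type*} [Monoid A] [NonUnitalRing R] [FunLike F A R]
    [MulHomClass F A R] (π : F) {p : R} (hp : Commute p (π 1)) (u : Aˣ) :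
    ⁅p, π ↑u⁻¹⁆ = -(π ↑u⁻¹ * ⁅p, π u⁆ * π ↑u⁻¹) := by
  have hleft : π ↑u⁻¹ * (p * π u) * π ↑u⁻¹ = π ↑u⁻¹ * p := by
    rw [mul_assoc, mul_assoc, ← map_mul, u.mul_inv, hp.eq, ← mul_assoc, ← map_mul, mul_one]
  have hright : π ↑u⁻¹ * (π u * p) * π ↑u⁻¹ = p * π ↑u⁻¹ := by
    rw [← mul_assoc, ← map_mul, u.inv_mul, ← hp.eq, mul_assoc, ← map_mul, one_mul]
  rw [Ring.lie_def, Ring.lie_def, mul_sub, sub_mul, hleft, hright, neg_sub]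

variable {𝕜 H : Type*} [RCLike 𝕜] [NormedAddCommGroup H] [InnerProductSpace 𝕜 H]

theorem commute_starProjection_of_mem_invtSubmodule [CompleteSpace H] {K : Submodule 𝕜 H}
    [K.HasOrthogonalProjection] {T : H →L[𝕜] H}
    (hT : K ∈ Module.End.invtSubmodule T.toLinearMap)
    (hT' : K ∈ Module.End.invtSubmodule (star T).toLinearMap) : Commute K.starProjection T := by
  rw [ContinuousLinearMap.IsIdempotentElem.commute_iff K.isIdempotentElem_starProjection,
    K.range_starProjection, K.ker_starProjection]
  exact ⟨hT, ContinuousLinearMap.orthogonal_mem_invtSubmodule hT'⟩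

theorem norm_inner_le_norm_lie_starProjection (K : Submodule 𝕜 H) [K.HasOrthogonalProjection]
    {T : H →L[𝕜] H} {ξ η : H} (hη : η ∈ Kᗮ) (hξ : T (K.starProjection ξ) = T ξ) :
    ‖⟪η, T ξ⟫_𝕜‖ ≤ ‖η‖ * (‖⁅K.starProjection, T⁆‖ * ‖ξ‖) := by
  have hinner : ⟪η, ⁅K.starProjection, T⁆ (K.starProjection ξ)⟫_𝕜 = -⟪η, T ξ⟫_𝕜 := by
    have hidem : K.starProjection (K.starProjection ξ) = K.starProjection ξ :=
      Submodule.starProjection_eq_self_iff.2 (K.starProjection_apply_mem ξ)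
    simp [Ring.lie_def, hidem, hξ, inner_sub_right,
      K.inner_left_of_mem_orthogonal (K.starProjection_apply_mem _) hη]
  rw [← norm_neg, ← hinner]
  refine (norm_inner_le_norm _ _).trans ?_
  gcongr
  exact ContinuousLinearMap.le_opNorm_of_le _ (K.norm_starProjection_apply_le ξ)

end Commutator

section CyclicSubspace

variable {𝕜 A H : Type*} [RCLike 𝕜] [NonUnitalSemiring A] [Module 𝕜 A] [Star A]
  [NormedAddCommGroup H] [InnerProductSpace 𝕜 H] [CompleteSpace H]
  (π : A →⋆ₙₐ[𝕜] (H →L[𝕜] H)) (B : NonUnitalStarSubalgebra 𝕜 A) (ξ : H)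

/-- The closed cyclic subspace generated by `ξ` under the representation `π` of `B`. As `B` need not
be unital, it may fail to contain `ξ`. -/
def cyclicSubspace : Submodule 𝕜 H :=
  (Submodule.span 𝕜 ((fun b => π b ξ) '' (B : Set A))).topologicalClosure

instance : CompleteSpace (cyclicSubspace π B ξ) :=
  (Submodule.isClosed_topologicalClosure _).completeSpace_coe

variable {B}

theorem map_apply_mem_cyclicSubspace {b : A} (hb : b ∈ B) : π b ξ ∈ cyclicSubspace π B ξ :=
  Submodule.le_topologicalClosure _ (Submodule.subset_span ⟨b, hb, rfl⟩)

theorem cyclicSubspace_mem_invtSubmodule {b : A} (hb : b ∈ B) :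
    cyclicSubspace π B ξ ∈ Module.End.invtSubmodule (π b).toLinearMap := by
  refine Submodule.topologicalClosure_mem_invtSubmodule ?_
  rw [Module.End.mem_invtSubmodule_iff_map_le, Submodule.map_span_le]
  rintro _ ⟨c, hc, rfl⟩
  exact Submodule.subset_span ⟨b * c, mul_mem hb hc, by simp⟩

theorem commute_starProjection_cyclicSubspace {b : A} (hb : b ∈ B) :
    Commute (cyclicSubspace π B ξ).starProjection (π b) :=
  commute_starProjection_of_mem_invtSubmodule (cyclicSubspace_mem_invtSubmodule π ξ hb) <| by
    rw [← map_star]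
    exact cyclicSubspace_mem_invtSubmodule π ξ (star_mem hb)

theorem map_starProjection_cyclicSubspace [TopologicalSpace A] (hπ : Continuous π) {a : A}
    (ha : a ∈ closure ((a * ·) '' (B : Set A))) :
    π a ((cyclicSubspace π B ξ).starProjection ξ) = π a ξ := by
  set P := (cyclicSubspace π B ξ).starProjection
  have hclosed : IsClosed {x | π x (P ξ) = π x ξ} :=
    isClosed_eq (by fun_prop) (by fun_prop)
  refine closure_minimal ?_ hclosed ha
  rintro _ ⟨b, hb, rfl⟩
  have hPb : π b (P ξ) = π b ξ :=
    calc π b (P ξ) = P (π b ξ) :=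
          DFunLike.congr_fun (commute_starProjection_cyclicSubspace π ξ hb).eq.symm ξ
      _ = π b ξ := Submodule.starProjection_eq_self_iff.2 (map_apply_mem_cyclicSubspace π ξ hb)
  simp [hPb]

theorem mem_orthogonal_cyclicSubspace {η : H} (hη : ∀ b ∈ B, ⟪η, π b ξ⟫_𝕜 = 0) :
    η ∈ (cyclicSubspace π B ξ)ᗮ := by
  rw [cyclicSubspace, Submodule.orthogonal_closure, Submodule.mem_orthogonal']
  refine (Submodule.span_le (p := LinearMap.ker (innerₛₗ 𝕜 η))).2 ?_
  rintro _ ⟨b, hb, rfl⟩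
  exact hη b hb

end CyclicSubspace

section QuotientSeminorm

variable {A : Type u} [NonUnitalCStarAlgebra A] {B : NonUnitalStarSubalgebra ℂ A}

theorem quotientSeminorm_le_norm_sub {b : A} (hb : b ∈ B) (a : A) :
    quotientSeminorm B a ≤ ‖a - b‖ :=
  ciInf_le ⟨0, Set.forall_mem_range.2 fun _ => norm_nonneg _⟩ (⟨b, hb⟩ : B)

theorem quotientSeminorm_le_norm (a : A) : quotientSeminorm B a ≤ ‖a‖ := by
  simpa using quotientSeminorm_le_norm_sub (zero_mem B) a

theorem quotientSeminorm_eq_zero_of_mem {b : A} (hb : b ∈ B) : quotientSeminorm B b = 0 :=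
  le_antisymm (by simpa using quotientSeminorm_le_norm_sub hb b) (apply_nonneg _ _)

theorem norm_lie_map_le_quotientSeminorm {D : Type*} [CStarAlgebra D] (π : A →⋆ₙₐ[ℂ] D) {p : D}
    (hp : IsStarProjection p) (hpB : ∀ b ∈ B, Commute p (π b)) (a : A) :
    ‖⁅p, π a⁆‖ ≤ quotientSeminorm B a := by
  rw [quotientSeminorm_apply]
  refine le_ciInf fun b => ?_
  calc ‖⁅p, π a⁆‖ = ‖⁅p, π (a - b)⁆‖ := by
        rw [map_sub, Ring.lie_def, Ring.lie_def, mul_sub, sub_mul, (hpB b b.2).eq,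
          sub_sub_sub_cancel_right]
    _ ≤ ‖π (a - b)‖ := norm_lie_le_of_isStarProjection hp _
    _ ≤ ‖a - b‖ := NonUnitalStarAlgHom.norm_apply_le π _

theorem exists_norm_lie_map_eq_quotientSeminorm {a : A}
    (ha : a ∈ closure ((a * ·) '' (B : Set A))) :
    ∃ (D : Type u) (_ : CStarAlgebra D) (π : A →⋆ₙₐ[ℂ] D) (p : D),
      (∀ x, ‖⁅p, π x⁆‖ ≤ quotientSeminorm B x) ∧ ‖⁅p, π a⁆‖ = quotientSeminorm B a := by
  obtain ⟨ψ, hψL, hψa⟩ := exists_dual_eq_seminorm (quotientSeminorm B) a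
  obtain ⟨H, _, _, _, π, ξ, η, hξ, hη, hψ⟩ :=
    exists_rep_eq_inner ψ fun x => (hψL x).trans (quotientSeminorm_le_norm x)
  have hπ : Continuous π := AddMonoidHomClass.continuous_of_bound π 1 fun x => by
    simpa using NonUnitalStarAlgHom.norm_apply_le π x
  set K := cyclicSubspace π B ξ
  have hηK : η ∈ Kᗮ := mem_orthogonal_cyclicSubspace π ξ fun b hb => by
    simpa [hψ, quotientSeminorm_eq_zero_of_mem hb] using hψL b
  have hle (x : A) : ‖⁅K.starProjection, π x⁆‖ ≤ quotientSeminorm B x :=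
    norm_lie_map_le_quotientSeminorm π isStarProjection_starProjection
      (fun b hb => commute_starProjection_cyclicSubspace π ξ hb) x
  refine ⟨H →L[ℂ] H, inferInstance, π, K.starProjection, hle, (hle a).antisymm ?_⟩
  calc quotientSeminorm B a = ‖⟪η, π a ξ⟫_ℂ‖ := by
        rw [← hψ, hψa, RCLike.norm_of_nonneg (apply_nonneg _ _)]
    _ ≤ ‖η‖ * (‖⁅K.starProjection, π a⁆‖ * ‖ξ‖) :=
        norm_inner_le_norm_lie_starProjection K hηK (map_starProjection_cyclicSubspace π ξ hπ ha)
    _ ≤ 1 * (‖⁅K.starProjection, π a⁆‖ * 1) := by gcongr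
    _ = ‖⁅K.starProjection, π a⁆‖ := by ring

theorem isLeibniz_quotientSeminorm (hB : ∀ a : A, a ∈ closure ((a * ·) '' (B : Set A))) :
    IsLeibniz (quotientSeminorm B) := by
  intro a c
  obtain ⟨D, _, π, p, hle, heq⟩ := exists_norm_lie_map_eq_quotientSeminorm (hB (a * c))
  calc quotientSeminorm B (a * c) = ‖⁅p, π a * π c⁆‖ := by rw [← heq, map_mul]
    _ ≤ ‖⁅p, π a⁆‖ * ‖π c‖ + ‖π a‖ * ‖⁅p, π c⁆‖ := norm_lie_mul_le _ _ _
    _ ≤ quotientSeminorm B a * ‖c‖ + ‖a‖ * quotientSeminorm B c := by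
        gcongr
        exacts [hle a, NonUnitalStarAlgHom.norm_apply_le π c,
          NonUnitalStarAlgHom.norm_apply_le π a, hle c]

end QuotientSeminorm

section Unital

variable {A : Type*} [CStarAlgebra A] {B : NonUnitalStarSubalgebra ℂ A}

theorem mem_closure_mul_image_of_one_mem (hB : (1 : A) ∈ B) (a : A) :
    a ∈ closure ((a * ·) '' (B : Set A)) :=
  subset_closure ⟨1, hB, mul_one a⟩

theorem quotientSeminorm_inv_le (hB : (1 : A) ∈ B) (u : Aˣ) :
    quotientSeminorm B (↑u⁻¹ : A) ≤ ‖(↑u⁻¹ : A)‖ ^ 2 * quotientSeminorm B (u : A) := by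
  obtain ⟨D, _, π, p, hle, heq⟩ :=
    exists_norm_lie_map_eq_quotientSeminorm (mem_closure_mul_image_of_one_mem hB ↑u⁻¹)
  have hp : Commute p (π 1) := by
    rw [commute_iff_lie_eq, ← norm_le_zero_iff, ← quotientSeminorm_eq_zero_of_mem hB]
    exact hle 1
  calc quotientSeminorm B (↑u⁻¹ : A) = ‖π ↑u⁻¹ * ⁅p, π u⁆ * π ↑u⁻¹‖ := by
        rw [← heq, lie_map_units_inv π hp, norm_neg]
    _ ≤ ‖π ↑u⁻¹‖ * ‖⁅p, π u⁆‖ * ‖π ↑u⁻¹‖ := norm_mul₃_le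
    _ ≤ ‖(↑u⁻¹ : A)‖ * quotientSeminorm B (u : A) * ‖(↑u⁻¹ : A)‖ := by
        gcongr
        exacts [NonUnitalStarAlgHom.norm_apply_le π _, hle u,
          NonUnitalStarAlgHom.norm_apply_le π _]
    _ = ‖(↑u⁻¹ : A)‖ ^ 2 * quotientSeminorm B (u : A) := by ring

end Unital

theorem ContainsBoundedApproxIdentity.mem_closure_mul_image {A : Type*} [NonUnitalCStarAlgebra A]
    {B : NonUnitalStarSubalgebra ℂ A} (hB : ContainsBoundedApproxIdentity B) (a : A) :
    a ∈ closure ((a * ·) '' (B : Set A)) := by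
  obtain ⟨l, hl, M, hM⟩ := hB
  have := hl.neBot
  exact mem_closure_of_tendsto (hl.tendsto_mul_left a) (hM.mono fun e he => ⟨e, he.1, rfl⟩)

theorem theorem3p1_general :
    (∀ (A : Type*) [NonUnitalCStarAlgebra A] (B : NonUnitalStarSubalgebra ℂ A),
      (∀ a : A, a ∈ closure ((a * ·) '' (B : Set A))) → IsLeibniz (quotientSeminorm B)) ∧
    (∀ (A : Type*) [CStarAlgebra A] (B : NonUnitalStarSubalgebra ℂ A),
      (1 : A) ∈ B → IsStronglyLeibniz (quotientSeminorm B)) :=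
  ⟨fun _ _ _ hB => isLeibniz_quotientSeminorm hB, fun _ _ _ hB =>
    { isLeibniz := isLeibniz_quotientSeminorm (mem_closure_mul_image_of_one_mem hB)
      map_one := quotientSeminorm_eq_zero_of_mem hB
      map_inv_le := quotientSeminorm_inv_le hB }⟩

theorem theorem3p1 :
    (∀ (A : Type*) [NonUnitalCStarAlgebra A] (B : NonUnitalStarSubalgebra ℂ A),
      IsClosed (B : Set A) → ContainsBoundedApproxIdentity B →
        IsLeibniz (quotientSeminorm B)) ∧
    (∀ (A : Type*) [CStarAlgebra A] (B : NonUnitalStarSubalgebra ℂ A),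
      IsClosed (B : Set A) → (1 : A) ∈ B →
        IsStronglyLeibniz (quotientSeminorm B)) :=
  theorem3p1_general.imp (fun h A _ B _ hB => h A B hB.mem_closure_mul_image)
    fun h A _ B _ hB => h A B hB
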